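/- Let $p\ne 2,3$ be a prime and let $E/\mathbb{Q}_p$ be an elliptic curve with good supersingular reduction, i.e. a minimal Weierstrass equation of $E$ over $\mathbb{Z}_p$ reduces modulo $p$ to an elliptic curve which has no nonzero $p$-torsion point over $\overline{\mathbb{F}}_p$. For a point $P\in E(\overline{\mathbb{Q}}_p)$ let $\mathbb{Q}_p(P)$ denote the field obtained by adjoining to $\mathbb{Q}_p$ the coordinates of $P$, and define the $p$-degree of $E$ by $$d_p(E)=\min\{[\mathbb{Q}_p(P):\mathbb{Q}_p] : P\in E[p],\ P\neq\mathcal{O}\}.$$ Then $d_p(E)=p^2-1$. Equivalently, $[\mathbb{Q}_p(P):\mathbb{Q}_p]=p^2-1$ for every nonzero $p$-torsion point $P\in E(\overline{\mathbb{Q}}_p)$. -/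

import Mathlib

open WeierstrassCurve

/-- An elliptic curve `W` over a field `k` of characteristic `p` is supersingular if it has no
nonzero `p`-torsion point over an algebraic closure of `k`. -/
def IsSupersingularCurve (p : ℕ) {k : Type*} [Field k] [CharP k p] (W : WeierstrassCurve k)
    [W.IsElliptic] : Prop :=
  open scoped Classical in
  ∀ P : (W.baseChange (AlgebraicClosure k)).toAffine.Point, p • P = 0 → P = 0

/-- The residue field of `ℤ_p` has characteristic `p`. -/
instance charP_residueField_padicInt (p : ℕ) [Fact p.Prime] :
    CharP (IsLocalRing.ResidueField ℤ_[p]) p :=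
  charP_of_injective_ringHom (f := (PadicInt.residueField (p := p)).symm.toRingHom)
    (PadicInt.residueField (p := p)).symm.injective p

/-- An elliptic curve over `ℚ_p` has good supersingular reduction if a minimal Weierstrass
equation over `ℤ_p` for it reduces to a supersingular elliptic curve over the residue field. -/
def HasGoodSupersingularReduction (p : ℕ) [Fact p.Prime] (E : WeierstrassCurve ℚ_[p]) : Prop :=
  ∃ h : (E.minimal ℤ_[p]).HasGoodReduction ℤ_[p],
    haveI : ((E.minimal ℤ_[p]).reduction ℤ_[p]).IsElliptic :=
      (hasGoodReduction_iff_isElliptic_reduction ℤ_[p]).mp h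
    IsSupersingularCurve p ((E.minimal ℤ_[p]).reduction ℤ_[p])

/-- The field of definition `F(P)` of a point `P` over an extension `L` of `F`: the subfield of `L`
generated over `F` by the coordinates of `P` (just `F` for the point at infinity). -/
def fieldOfPoint {F L : Type*} [Field F] [Field L] [Algebra F L] {W : WeierstrassCurve L} :
    W.toAffine.Point → IntermediateField F L
  | .zero => ⊥
  | .some x y _ => IntermediateField.adjoin F {x, y}

/-- The set of nonzero `p`-torsion points of `E` over the algebraic closure of `ℚ_p`. -/
def nonzeroTorsion (p : ℕ) [Fact p.Prime] (E : WeierstrassCurve ℚ_[p]) :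
    Set (E.baseChange (AlgebraicClosure ℚ_[p])).toAffine.Point :=
  open scoped Classical in {P | p • P = 0 ∧ P ≠ 0}

/-- The `p`-degree of `E`: the minimum of the degrees `[ℚ_p(P) : ℚ_p]` over all nonzero
`p`-torsion points `P` of `E`. -/
noncomputable def pDegree (p : ℕ) [Fact p.Prime] (E : WeierstrassCurve ℚ_[p]) : ℕ :=
  sInf {d | ∃ P ∈ nonzeroTorsion p E, Module.finrank ℚ_[p] (fieldOfPoint (F := ℚ_[p]) P) = d}

/-! On a minimal model over ℤ_p the p-th division polynomial has degree (p² - 1)/2 and leading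
coefficient p. Supersingularity leaves its reduction without roots, so modulo p it is a nonzero
constant (`IsSupersingularCurve.coeff_preΨ`). Hence each root x' has |x'| > 1 and |x'|^((p² - 1)/2)
= p (`PadicAlgCl.norm_pow_eq_of_root`), and the equation of the curve gives |y'|² = |x'|³. So z =
x'/y', up to sign the parameter of the formal group, has |z|^(p² - 1) = 1/p, and ramification forces
p² - 1 to divide the degree of every finite extension containing z
(`PadicAlgCl.dvd_finrank_of_norm_pow`). The degree is at most p² - 1 because x is a root of a
polynomial of degree (p² - 1)/2 and y is quadratic over ℚ_p(x)
(`WeierstrassCurve.finrank_adjoin_le`).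

The rest identifies p-torsion with zeros of the division polynomial over an arbitrary field
(`divisionSeq_eq_zero_iff`), as is needed both over ℚ_p and over the residue field. The
x-coordinates of the multiples of P define a sequence that obeys the division polynomial recursion
up to the first r with rP = 0. Past r, Ward's relation (`normEDS_mul`) confines the zeros to
multiples of r. -/

/-! ### The x-coordinates of P + Q and P - Q. -/

namespace WeierstrassCurve.Affine

variable {K : Type*} [Field K] [DecidableEq K] {W : Affine K}

/-- The symmetric polynomial `S` with `(x(P + Q) - z) (x(P - Q) - z) (x(P) - x(Q))² =
S(x(P), x(Q), z)`. -/
def addSubForm (W : Affine K) (q r z : K) : K :=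
  q ^ 2 * r ^ 2 + q ^ 2 * z ^ 2 + r ^ 2 * z ^ 2 - 2 * q * r * z * (q + r + z) - W.b₂ * q * r * z
    - W.b₄ * (q * r + q * z + r * z) - W.b₆ * (q + r + z) - W.b₈

omit [DecidableEq K] in
lemma addSubForm_swap (q r z : K) : W.addSubForm q r z = W.addSubForm z r q := by
  simp only [addSubForm]; ring

namespace Point

/-- The `x`-coordinate of a point, with junk value `1` at infinity. -/
noncomputable abbrev xCoord (P : W.Point) : K := P.xRep 0

omit [DecidableEq K] in
lemma xCoord_some {x y : K} (h : W.Nonsingular x y) : (some x y h).xCoord = x := by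
  simp [xCoord]

omit [DecidableEq K] in
lemma xCoord_eq_iff {P Q : W.Point} (hP : P ≠ 0) (hQ : Q ≠ 0) :
    P.xCoord = Q.xCoord ↔ P = Q ∨ P = -Q := by
  rcases P with _ | ⟨x₁, y₁, h₁⟩
  · exact absurd rfl hP
  rcases Q with _ | ⟨x₂, y₂, h₂⟩
  · exact absurd rfl hQ
  rw [xCoord_some, xCoord_some]
  exact X_eq_iff

lemma xCoord_add_sub {P Q : W.Point} (hP : P ≠ 0) (hQ : Q ≠ 0) (hPQ : P.xCoord ≠ Q.xCoord) :
    ((P + Q).xCoord + (P - Q).xCoord) * (P.xCoord - Q.xCoord) ^ 2 =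
      2 * P.xCoord * Q.xCoord * (P.xCoord + Q.xCoord) + W.b₂ * P.xCoord * Q.xCoord
        + W.b₄ * (P.xCoord + Q.xCoord) + W.b₆ ∧
    (P + Q).xCoord * (P - Q).xCoord * (P.xCoord - Q.xCoord) ^ 2 =
      P.xCoord ^ 2 * Q.xCoord ^ 2 - W.b₄ * P.xCoord * Q.xCoord
        - W.b₆ * (P.xCoord + Q.xCoord) - W.b₈ := by
  rcases P with _ | ⟨x₁, y₁, h₁⟩
  · exact absurd rfl hP
  rcases Q with _ | ⟨x₂, y₂, h₂⟩
  · exact absurd rfl hQ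
  rw [xCoord_some, xCoord_some] at hPQ ⊢
  rw [sub_eq_add_neg, neg_some, add_of_X_ne hPQ, add_of_X_ne hPQ, xCoord_some, xCoord_some,
    slope_of_X_ne hPQ, slope_of_X_ne hPQ]
  have e₁ := (equation_iff ..).mp h₁.1
  have e₂ := (equation_iff ..).mp h₂.1
  have hD : x₁ - x₂ ≠ 0 := sub_ne_zero.mpr hPQ
  set f₁ := x₁ ^ 3 + W.a₂ * x₁ ^ 2 + W.a₄ * x₁ + W.a₆ with hf₁
  set f₂ := x₂ ^ 3 + W.a₂ * x₂ ^ 2 + W.a₄ * x₂ + W.a₆ with hf₂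
  set α₁ := W.a₁ * x₁ + W.a₃ with hα₁
  set α₂ := W.a₁ * x₂ + W.a₃ with hα₂
  -- Replacing Q by -Q sends T to -T - α₁α₂, so `hTT` removes the y-coordinates from the product of
  -- the two x-coordinates.
  set T := 2 * y₁ * y₂ + α₂ * y₁ + α₁ * y₂ with hT
  set s := f₁ + f₂ - (W.a₂ + x₁ + x₂) * (x₁ - x₂) ^ 2 with hs
  have hTT : T * (T + α₁ * α₂) = 4 * f₁ * f₂ + f₁ * α₂ ^ 2 + f₂ * α₁ ^ 2 := by
    rw [hT, hα₁, hα₂]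
    linear_combination (4 * (y₂ ^ 2 + α₂ * y₂) + α₂ ^ 2) * e₁ + (4 * f₁ + α₁ ^ 2) * e₂
  have hU : W.addX x₁ x₂ ((y₁ - y₂) / (x₁ - x₂)) = (s - T) / (x₁ - x₂) ^ 2 := by
    rw [addX, eq_div_iff (pow_ne_zero 2 hD)]
    field_simp
    rw [hs, hT]
    linear_combination e₁ + e₂
  have hV : W.addX x₁ x₂ ((y₁ - W.negY x₂ y₂) / (x₁ - x₂)) =
      (s + T + α₁ * α₂) / (x₁ - x₂) ^ 2 := by
    rw [addX, negY, eq_div_iff (pow_ne_zero 2 hD)]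
    field_simp
    rw [hs, hT]
    linear_combination e₁ + e₂
  rw [hU, hV]
  constructor
  · field_simp
    simp only [hs, hα₁, hα₂, hf₁, hf₂, b₂, b₄, b₆]
    ring
  · field_simp
    rw [show (s - T) * (s + T + α₁ * α₂) = s ^ 2 + s * (α₁ * α₂) - T * (T + α₁ * α₂) by ring, hTT]
    simp only [hs, hα₁, hα₂, hf₁, hf₂, b₄, b₆, b₈]
    ring

lemma xCoord_add_sub_sub {P Q : W.Point} (hP : P ≠ 0) (hQ : Q ≠ 0) (hPQ : P.xCoord ≠ Q.xCoord)
    (z : K) : ((P + Q).xCoord - z) * ((P - Q).xCoord - z) * (P.xCoord - Q.xCoord) ^ 2 =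
      W.addSubForm P.xCoord Q.xCoord z := by
  obtain ⟨h₁, h₂⟩ := xCoord_add_sub hP hQ hPQ
  rw [addSubForm]
  linear_combination h₂ - z * h₁

lemma xCoord_add_self {x y : K} (h : W.Nonsingular x y) (hy : 2 * y + W.a₁ * x + W.a₃ ≠ 0) :
    (some x y h + some x y h).xCoord * (2 * y + W.a₁ * x + W.a₃) ^ 2 =
      x ^ 4 - W.b₄ * x ^ 2 - 2 * W.b₆ * x - W.b₈ := by
  have hne : y ≠ W.negY x y := by
    rw [negY]
    intro h'
    exact hy (by linear_combination h')
  have e := (equation_iff ..).mp h.1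
  rw [add_self_of_Y_ne hne, xCoord_some, slope_of_Y_ne rfl hne, addX, negY,
    show y - (-y - W.a₁ * x - W.a₃) = 2 * y + W.a₁ * x + W.a₃ by ring]
  obtain ⟨D, hD⟩ : ∃ D, D = 2 * y + W.a₁ * x + W.a₃ := ⟨_, rfl⟩
  rw [← hD] at hy ⊢
  field_simp
  rw [hD]
  simp only [b₄, b₆, b₈]
  linear_combination (-(W.a₁ ^ 2 + 4 * W.a₂ + 8 * x)) * e

end Point

end WeierstrassCurve.Affine

/-! ### Sequences built from differences of x-coordinates. -/

section DifferenceSequence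

variable {K : Type*} [Field K]

/-- The sequence `u` with `u(0) = 0`, `u(1) = 1`, `u(2) = b`, and
`u(n + 1) u(n - 1) = u(n)² (X(1) - X(n))`. -/
def differenceSeq (b : K) (X : ℕ → K) : ℕ → K
  | 0 => 0
  | 1 => 1
  | 2 => b
  | n + 3 => differenceSeq b X (n + 2) ^ 2 * (X 1 - X (n + 2)) / differenceSeq b X (n + 1)

variable {b : K} {X : ℕ → K} {r : ℕ}

lemma differenceSeq_mul_of_ne {k : ℕ} (hk : 1 ≤ k) (h : differenceSeq b X k ≠ 0) :
    differenceSeq b X (k + 2) * differenceSeq b X k =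
      differenceSeq b X (k + 1) ^ 2 * (X 1 - X (k + 1)) := by
  obtain ⟨k, rfl⟩ := Nat.exists_eq_add_of_le' hk
  rw [differenceSeq, div_mul_cancel₀ _ h]

/-- This is the analogue of ψ(m+n)ψ(m-n) = ψ(m)²ψ(n)²(x(nP) - x(mP)) with m = n + k. The hypotheses
`hX` and `hX₂` are what the symmetry of `addSubForm` yields; the bound r restricts everything to
multiples before the first zero. -/
lemma differenceSeq_mul_eq
    (hne : ∀ k, 1 ≤ k → k < r → differenceSeq b X k ≠ 0)
    (hX : ∀ n m, n + 3 < r → m + 3 < r →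
      (X (n + 3) - X (m + 2)) * (X (n + 1) - X (m + 2)) * (X (n + 2) - X 1) ^ 2 =
        (X (m + 3) - X (n + 2)) * (X (m + 1) - X (n + 2)) * (X (m + 2) - X 1) ^ 2)
    (hX₂ : ∀ m, m + 3 < r → (X 2 - X (m + 2)) * b ^ 2 =
      (X (m + 3) - X 1) * (X (m + 1) - X 1) * (X (m + 2) - X 1) ^ 2) :
    ∀ n k, 1 ≤ n → 1 ≤ k → 2 * n + k ≤ r →
      differenceSeq b X (2 * n + k) * differenceSeq b X k =
        differenceSeq b X (n + k) ^ 2 * differenceSeq b X n ^ 2 * (X n - X (n + k)) := by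
  have E₁ : ∀ k, 1 ≤ k → k < r → differenceSeq b X (k + 2) * differenceSeq b X k =
      differenceSeq b X (k + 1) ^ 2 * (X 1 - X (k + 1)) := fun k hk hkr ↦
    differenceSeq_mul_of_ne hk (hne k hk hkr)
  intro n
  induction n using Nat.strong_induction_on with
  | _ n ih =>
  intro k hn hk hr
  match n, hn with
  | 1, _ =>
    have := E₁ k hk (by omega)
    rw [show 2 * 1 + k = k + 2 by ring, show 1 + k = k + 1 by ring, this]
    simp [differenceSeq]
  -- The general step uses n - 1 and n - 2, both positive, so n = 2 stands apart and rests on the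
  -- duplication formula `hX₂`.
  | 2, _ =>
    have a₁ := E₁ (k + 2) (by omega) (by omega)
    have a₂ := E₁ k (by omega) (by omega)
    have a₃ := E₁ (k + 1) (by omega) (by omega)
    have a₄ := hX₂ k (by omega)
    have n₁ := hne (k + 1) (by omega) (by omega)
    have n₃ := hne (k + 3) (by omega) (by omega)
    have n₂ := hne (k + 2) (by omega) (by omega)
    rw [show 2 * 2 + k = k + 2 + 2 by ring, show 2 + k = k + 2 by ring]
    rw [show differenceSeq b X 2 = b from rfl]
    simp only [add_assoc, Nat.reduceAdd] at *
    have a₁' : X (k + 3) - X 1 = -(differenceSeq b X (k + 4) * differenceSeq b X (k + 2)) /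
      differenceSeq b X (k + 3) ^ 2 := by rw [a₁]; field_simp; ring
    have a₂' : X (k + 1) - X 1 = -(differenceSeq b X (k + 2) * differenceSeq b X k) /
      differenceSeq b X (k + 1) ^ 2 := by rw [a₂]; field_simp; ring
    have a₃' : X (k + 2) - X 1 = -(differenceSeq b X (k + 3) * differenceSeq b X (k + 1)) /
      differenceSeq b X (k + 2) ^ 2 := by rw [a₃]; field_simp; ring
    rw [mul_assoc, mul_comm (b ^ 2), a₄, a₁', a₂', a₃']
    field_simp
  | j + 3, _ =>
    have c₁ := ih (j + 1) (by omega) (k + 2) (by omega) (by omega) (by omega)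
    have c₂ := ih (j + 2) (by omega) (k + 2) (by omega) (by omega) (by omega)
    have c₃ := ih (j + 2) (by omega) k (by omega) (by omega) (by omega)
    have a₂ := E₁ (j + 1) (by omega) (by omega)
    have a₃ := E₁ (j + k + 2) (by omega) (by omega)
    -- In this instance every difference except X(j + 3) - X(j + k + 3) is already known from the
    -- induction hypothesis or the defining recursion.
    have a₄ := hX j (j + k + 1) (by omega) (by omega)
    rw [show 2 * (j + 1) + (k + 2) = 2 * j + k + 4 by ring,
      show j + 1 + (k + 2) = j + k + 3 by ring] at c₁
    rw [show 2 * (j + 2) + (k + 2) = 2 * j + k + 6 by ring,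
      show j + 2 + (k + 2) = j + k + 4 by ring] at c₂
    rw [show 2 * (j + 2) + k = 2 * j + k + 4 by ring,
      show j + 2 + k = j + k + 2 by ring] at c₃
    rw [show 2 * (j + 3) + k = 2 * j + k + 6 by ring,
      show j + 3 + k = j + k + 3 by ring]
    simp only [add_assoc, Nat.reduceAdd] at *
    have n₁ := hne (j + 1) (by omega) (by omega)
    have n₂ := hne (j + 2) (by omega) (by omega)
    have n₃ := hne (j + 3) (by omega) (by omega)
    have m₁ := hne (j + (k + 2)) (by omega) (by omega)
    have m₂ := hne (j + (k + 3)) (by omega) (by omega)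
    have m₃ := hne (j + (k + 4)) (by omega) (by omega)
    have m₄ := hne (2 * j + (k + 4)) (by omega) (by omega)
    have m₅ := hne (k + 2) (by omega) (by omega)
    have c₁' : X (j + 1) - X (j + (k + 3)) = differenceSeq b X (2 * j + (k + 4)) *
      differenceSeq b X (k + 2) / (differenceSeq b X (j + (k + 3)) ^ 2 *
        differenceSeq b X (j + 1) ^ 2) := by rw [c₁]; field_simp
    have c₂' : X (j + (k + 4)) - X (j + 2) = -(differenceSeq b X (2 * j + (k + 6)) *
      differenceSeq b X (k + 2)) / (differenceSeq b X (j + (k + 4)) ^ 2 *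
        differenceSeq b X (j + 2) ^ 2) := by rw [c₂]; field_simp; ring
    have c₃' : X (j + (k + 2)) - X (j + 2) = -(differenceSeq b X (2 * j + (k + 4)) *
      differenceSeq b X k) / (differenceSeq b X (j + (k + 2)) ^ 2 *
        differenceSeq b X (j + 2) ^ 2) := by rw [c₃]; field_simp; ring
    have a₂' : X (j + 2) - X 1 = -(differenceSeq b X (j + 3) * differenceSeq b X (j + 1)) /
      differenceSeq b X (j + 2) ^ 2 := by rw [a₂]; field_simp; ring
    have a₃' : X (j + (k + 3)) - X 1 = -(differenceSeq b X (j + (k + 4)) *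
      differenceSeq b X (j + (k + 2))) / differenceSeq b X (j + (k + 3)) ^ 2 := by
      rw [a₃]; field_simp; ring
    rw [c₁', c₂', c₃', a₂', a₃'] at a₄
    field_simp at a₄
    rw [← a₄]
    ring

end DifferenceSequence

/-! ### Comparison with division polynomials up to the first vanishing multiple. -/

namespace WeierstrassCurve.Affine.Point

variable {K : Type*} [Field K] [DecidableEq K] {W : Affine K} {x y : K} {r : ℕ}

omit [DecidableEq K] in
lemma ψ₂_sq_eq (h : W.Nonsingular x y) :
    (2 * y + W.a₁ * x + W.a₃) ^ 2 = W.Ψ₂Sq.eval x := by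
  have e := (equation_iff ..).mp h.1
  simp only [Ψ₂Sq, b₂, b₄, b₆]
  simp
  linear_combination 4 * e

lemma two_nsmul_eq_zero_iff (h : W.Nonsingular x y) :
    2 • some x y h = 0 ↔ 2 * y + W.a₁ * x + W.a₃ = 0 := by
  rw [two_nsmul]
  refine ⟨fun h₀ ↦ ?_, fun h₀ ↦ add_self_of_Y_eq (by rw [negY]; linear_combination h₀)⟩
  by_contra hb
  rw [add_self_of_Y_ne (fun h' ↦ hb (by rw [negY] at h'; linear_combination h'))] at h₀
  exact some_ne_zero _ h₀

/-- The sequence of `x`-coordinates of the multiples of a point. -/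
noncomputable def xSeq (P : W.Point) (n : ℕ) : K := (n • P).xCoord

lemma xCoord_nsmul (P : W.Point) (n : ℕ) : (n • P).xCoord = P.xSeq n := rfl

lemma xSeq_one (h : W.Nonsingular x y) : (some x y h).xSeq 1 = x := by
  rw [xSeq, one_nsmul, xCoord_some]

lemma xSeq_ne {P : W.Point} (hr : ∀ k, 0 < k → k < r → k • P ≠ 0) {m n : ℕ} (hn : 0 < n)
    (hnm : n < m) (hmn : m + n < r) : P.xSeq m ≠ P.xSeq n := by
  rw [xSeq, xSeq, Ne, xCoord_eq_iff (hr m (by omega) (by omega)) (hr n hn (by omega))]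
  rintro (h | h)
  · refine hr (m - n) (by omega) (by omega) ?_
    rw [sub_nsmul _ hnm.le, h, add_neg_cancel]
  · refine hr (m + n) (by omega) (by omega) ?_
    rw [add_nsmul, h, neg_add_cancel]

lemma succ_nsmul_sub (P : W.Point) (n : ℕ) : (n + 1) • P - 1 • P = n • P := by
  rw [add_nsmul, add_sub_cancel_right]

lemma xSeq_biquadratic {P : W.Point} (hr : ∀ k, 0 < k → k < r → k • P ≠ 0) {n : ℕ}
    (hn : n + 3 < r) (z : K) :
    (P.xSeq (n + 3) - z) * (P.xSeq (n + 1) - z) * (P.xSeq (n + 2) - P.xSeq 1) ^ 2 =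
      W.addSubForm (P.xSeq (n + 2)) (P.xSeq 1) z := by
  have hne := xSeq_ne hr one_pos (show 1 < n + 2 by omega) (by omega)
  have := xCoord_add_sub_sub (hr (n + 2) (by omega) (by omega)) (hr 1 one_pos (by omega)) hne z
  rw [← add_nsmul, succ_nsmul_sub] at this
  exact this

/-- The duplication formula is the degenerate case Q = P of the identity for P ± Q. -/
lemma xSeq_two (h : W.Nonsingular x y) (hy : 2 * y + W.a₁ * x + W.a₃ ≠ 0) (z : K) :
    ((some x y h).xSeq 2 - z) * (2 * y + W.a₁ * x + W.a₃) ^ 2 = W.addSubForm x x z := by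
  have h₁ := xCoord_add_self h hy
  have h₂ := ψ₂_sq_eq h
  rw [← two_nsmul] at h₁
  rw [sub_mul, xSeq, h₁, h₂, Ψ₂Sq, addSubForm]
  simp
  ring

/-- The value at a point of the sequence of division polynomials. -/
noncomputable def divisionSeq (W : Affine K) (x y : K) (n : ℤ) : K :=
  normEDS (2 * y + W.a₁ * x + W.a₃) (W.Ψ₃.eval x) (W.preΨ₄.eval x) n

/-- The sequence built from the `x`-coordinates of the multiples of a point. -/
noncomputable def xDiffSeq (h : W.Nonsingular x y) (n : ℕ) : K :=
  differenceSeq (2 * y + W.a₁ * x + W.a₃) (some x y h).xSeq n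

section

variable (h : W.Nonsingular x y) (hr : ∀ k, 0 < k → k < r → k • some x y h ≠ 0)

include hr

lemma xDiffSeq_ne_zero : ∀ k, 1 ≤ k → k < r → xDiffSeq h k ≠ 0 := by
  intro k
  induction k using Nat.strong_induction_on with
  | _ k ih =>
  intro hk hkr
  match k, hk with
  | 1, _ => simp [xDiffSeq, differenceSeq]
  | 2, _ =>
    rw [xDiffSeq, differenceSeq, Ne, ← two_nsmul_eq_zero_iff h]
    exact hr 2 two_pos hkr
  | k + 3, _ =>
    rw [xDiffSeq, differenceSeq]
    refine div_ne_zero (mul_ne_zero (pow_ne_zero 2 (ih (k + 2) ?_ ?_ ?_)) ?_)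
      (ih (k + 1) ?_ ?_ ?_) <;> try omega
    exact sub_ne_zero.mpr (xSeq_ne hr one_pos (by omega) (by omega)).symm

lemma xDiffSeq_mul_eq {n k : ℕ} (hn : 1 ≤ n) (hk : 1 ≤ k) (hnk : 2 * n + k ≤ r) :
    xDiffSeq h (2 * n + k) * xDiffSeq h k =
      xDiffSeq h (n + k) ^ 2 * xDiffSeq h n ^ 2 *
        ((some x y h).xSeq n - (some x y h).xSeq (n + k)) := by
  refine differenceSeq_mul_eq (xDiffSeq_ne_zero h hr) (fun n m hn hm ↦ ?_) (fun m hm ↦ ?_)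
    n k hn hk hnk
  · rw [xSeq_biquadratic hr hn, xSeq_biquadratic hr hm, addSubForm_swap]
  · rw [xSeq_two h, xSeq_biquadratic hr hm, addSubForm_swap, xSeq_one]
    rw [Ne, ← two_nsmul_eq_zero_iff h]
    exact hr 2 two_pos (by omega)

lemma xDiffSeq_succ_mul {k : ℕ} (hk : 1 ≤ k) (hkr : k < r) :
    xDiffSeq h (k + 2) * xDiffSeq h k =
      xDiffSeq h (k + 1) ^ 2 * (x - (some x y h).xSeq (k + 1)) := by
  have := differenceSeq_mul_of_ne hk (xDiffSeq_ne_zero h hr k hk hkr)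
  rwa [xSeq_one h] at this

/-- For r ≥ 3, vanishing means x((r-1)P) = x(P), so (r-1)P = ±P. The plus sign would give (r-2)P =
0, which is excluded; the minus sign says rP = 0. -/
lemma xDiffSeq_eq_zero_iff (hr₁ : 1 ≤ r) : xDiffSeq h r = 0 ↔ r • some x y h = 0 := by
  match r, hr₁ with
  | 1, _ => simp [xDiffSeq, differenceSeq]
  | 2, _ => rw [two_nsmul_eq_zero_iff, xDiffSeq, differenceSeq]
  | k + 3, _ =>
    have n₁ := xDiffSeq_ne_zero h hr (k + 1) (by omega) (by omega)
    have n₂ := xDiffSeq_ne_zero h hr (k + 2) (by omega) (by omega)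
    have p₁ : (k + 1) • some x y h ≠ 0 := hr _ (by omega) (by omega)
    have key := xDiffSeq_succ_mul h hr (k := k + 1) (by omega) (by omega)
    have : xDiffSeq h (k + 3) = 0 ↔ x - (some x y h).xSeq (k + 2) = 0 := by
      rw [← mul_eq_zero_iff_right n₁, key, mul_eq_zero_iff_left (pow_ne_zero 2 n₂)]
    have hx' : x = (some x y h).xSeq (k + 2) ↔ (some x y h).xCoord = (some x y h).xSeq (k + 2) := by
      rw [xCoord_some]
    rw [this, sub_eq_zero, hx', xSeq, xCoord_eq_iff (some_ne_zero h) (hr _ (by omega) (by omega)),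
      succ_nsmul _ (k + 2), add_eq_zero_iff_eq_neg]
    generalize some x y h = P at *
    refine ⟨?_, fun h₁ ↦ Or.inr (by rw [h₁, neg_neg])⟩
    rintro (h₁ | h₁)
    · refine absurd ?_ p₁
      rw [succ_nsmul _ (k + 1)] at h₁
      exact add_eq_right.mp h₁.symm
    · exact neg_eq_iff_eq_neg.mp h₁.symm

lemma xDiffSeq_three (hr₃ : 3 ≤ r) : xDiffSeq h 3 = W.Ψ₃.eval x := by
  have hb : 2 * y + W.a₁ * x + W.a₃ ≠ 0 := by
    rw [Ne, ← two_nsmul_eq_zero_iff h]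
    exact hr 2 two_pos (by omega)
  have h₁ := xDiffSeq_succ_mul h hr le_rfl (by omega)
  have h₂ := xSeq_two h hb x
  rw [show xDiffSeq h 1 = 1 from rfl,
    show xDiffSeq h (1 + 1) = 2 * y + W.a₁ * x + W.a₃ from rfl] at h₁
  rw [addSubForm] at h₂
  simp [Ψ₃]
  linear_combination h₁ - h₂

lemma xDiffSeq_four (hr₄ : 4 ≤ r) :
    xDiffSeq h 4 = W.preΨ₄.eval x * (2 * y + W.a₁ * x + W.a₃) := by
  have hb : 2 * y + W.a₁ * x + W.a₃ ≠ 0 := by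
    rw [Ne, ← two_nsmul_eq_zero_iff h]
    exact hr 2 two_pos (by omega)
  have h₁ := xDiffSeq_succ_mul h hr (k := 2) (by omega) (by omega)
  have h₂ := xSeq_two h hb 0
  have h₃ := xSeq_two h hb x
  have h₄ := (xCoord_add_sub (hr 2 (by omega) (by omega)) (hr 1 (by omega) (by omega))
    (xSeq_ne hr one_pos one_lt_two (by omega))).1
  have h₅ := ψ₂_sq_eq h
  rw [← add_nsmul, succ_nsmul_sub _ 1] at h₄
  simp only [xCoord_nsmul, Nat.reduceAdd, xSeq_one] at h₄ h₁
  rw [xDiffSeq_three h hr (by omega),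
    show xDiffSeq h 2 = 2 * y + W.a₁ * x + W.a₃ from rfl] at h₁
  refine mul_right_cancel₀ hb (h₁.trans ?_)
  rw [mul_assoc, ← sq]
  generalize 2 * y + W.a₁ * x + W.a₃ = B at *
  generalize (some x y h).xSeq 2 = X₂ at *
  generalize (some x y h).xSeq 3 = X₃ at *
  have h₃' : W.Ψ₃.eval x = (x - X₂) * B ^ 2 := by
    rw [addSubForm] at h₃
    simp [Ψ₃]
    linear_combination h₃
  rw [sub_zero] at h₂
  have h₆ : W.Ψ₃.eval x ^ 2 * (x - X₃) = 2 * x * (x * B ^ 2 - X₂ * B ^ 2) ^ 2 -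
      (2 * (X₂ * B ^ 2) * x * (X₂ * B ^ 2 + x * B ^ 2) + W.b₂ * (X₂ * B ^ 2) * x * B ^ 2
        + W.b₄ * (X₂ * B ^ 2 + x * B ^ 2) * B ^ 2 + W.b₆ * (B ^ 2) ^ 2) := by
    rw [h₃']
    linear_combination - B ^ 4 * h₄
  rw [h₆, h₂, h₅]
  simp [Ψ₂Sq, preΨ₄, addSubForm, b₂, b₄, b₆, b₈]
  ring

lemma xDiffSeq_even {m : ℕ} (hm : 3 ≤ m) (hmr : 2 * m ≤ r) :
    xDiffSeq h (2 * m) * (2 * y + W.a₁ * x + W.a₃) = xDiffSeq h (m - 1) ^ 2 * xDiffSeq h m *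
      xDiffSeq h (m + 2) - xDiffSeq h (m - 2) * xDiffSeq h m * xDiffSeq h (m + 1) ^ 2 := by
  obtain ⟨m, rfl⟩ := Nat.exists_eq_add_of_le' hm
  have h₁ := xDiffSeq_mul_eq h hr (n := m + 2) (k := 2) (by omega) (by omega) (by omega)
  have h₂ := xDiffSeq_succ_mul h hr (k := m + 1) (by omega) (by omega)
  have h₃ := xDiffSeq_succ_mul h hr (k := m + 3) (by omega) (by omega)
  rw [show xDiffSeq h 2 = 2 * y + W.a₁ * x + W.a₃ from rfl,
    show 2 * (m + 2) + 2 = 2 * (m + 3) by ring] at h₁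
  simp only [add_assoc, Nat.reduceAdd, Nat.reduceSubDiff] at *
  linear_combination h₁ + xDiffSeq h (m + 4) ^ 2 * h₂ - xDiffSeq h (m + 2) ^ 2 * h₃

lemma xDiffSeq_odd {m : ℕ} (hm : 2 ≤ m) (hmr : 2 * m + 1 ≤ r) :
    xDiffSeq h (2 * m + 1) = xDiffSeq h (m + 2) * xDiffSeq h m ^ 3 -
      xDiffSeq h (m - 1) * xDiffSeq h (m + 1) ^ 3 := by
  obtain ⟨m, rfl⟩ := Nat.exists_eq_add_of_le' hm
  have h₁ := xDiffSeq_mul_eq h hr (n := m + 2) (k := 1) (by omega) (by omega) (by omega)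
  have h₂ := xDiffSeq_succ_mul h hr (k := m + 1) (by omega) (by omega)
  have h₃ := xDiffSeq_succ_mul h hr (k := m + 2) (by omega) (by omega)
  rw [show xDiffSeq h 1 = 1 from rfl] at h₁
  simp only [add_assoc, Nat.reduceAdd, Nat.reduceSubDiff] at *
  linear_combination h₁ + xDiffSeq h (m + 3) ^ 2 * h₂ - xDiffSeq h (m + 2) ^ 2 * h₃

/-- Both sequences share their values up to index 4 and their duplication recursions. The index n =
r is included, so the first vanishing multiple is detected. -/
lemma divisionSeq_eq_xDiffSeq (n : ℕ) (hn : n ≤ r) : divisionSeq W x y n = xDiffSeq h n := by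
  induction n using normEDSRec' with
  | zero => simp [divisionSeq, xDiffSeq, differenceSeq]
  | one => simp [divisionSeq, xDiffSeq, differenceSeq]
  | two => simp [divisionSeq, xDiffSeq, differenceSeq]
  | three => simpa [divisionSeq] using (xDiffSeq_three h hr hn).symm
  | four => simpa [divisionSeq] using (xDiffSeq_four h hr hn).symm
  | even m ih =>
    have hb : 2 * y + W.a₁ * x + W.a₃ ≠ 0 := by
      rw [Ne, ← two_nsmul_eq_zero_iff h]
      exact hr 2 two_pos (by omega)
    refine mul_right_cancel₀ hb ?_
    rw [xDiffSeq_even h hr (by omega) hn, ← ih _ (by omega) (by omega),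
      ← ih _ (by omega) (by omega), ← ih _ (by omega) (by omega), ← ih _ (by omega) (by omega),
      ← ih _ (by omega) (by omega)]
    have := normEDS_even (2 * y + W.a₁ * x + W.a₃) (W.Ψ₃.eval x) (W.preΨ₄.eval x) (m + 3)
    simp only [divisionSeq]
    push_cast
    convert this using 6 <;> ring
  | odd m ih =>
    rw [xDiffSeq_odd h hr (by omega) hn, ← ih _ (by omega) (by omega),
      ← ih _ (by omega) (by omega), ← ih _ (by omega) (by omega), ← ih _ (by omega) (by omega)]
    have := normEDS_odd (2 * y + W.a₁ * x + W.a₃) (W.Ψ₃.eval x) (W.preΨ₄.eval x) (m + 2)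
    simp only [divisionSeq]
    push_cast
    convert this using 6
    ring

end

end WeierstrassCurve.Affine.Point

/-! ### Ward's relation and the zeros of elliptic divisibility sequences. -/

/-- This specialisation shows that the generic sequence has no zero at a positive index. -/
lemma normEDS_two_three_two (n : ℕ) : normEDS (2 : ℤ) 3 2 n = n := by
  induction n using normEDSRec with
  | zero => simp
  | one => simp
  | two => simp
  | three => simp
  | four => simp
  | even m h₁ h₂ h₃ h₄ h₅ =>
    refine mul_right_cancel₀ (two_ne_zero (α := ℤ)) ?_
    have := normEDS_even (2 : ℤ) 3 2 ((m : ℤ) + 3)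
    push_cast at *
    rw [this, show (m : ℤ) + 3 - 1 = m + 2 by ring, show (m : ℤ) + 3 - 2 = m + 1 by ring,
      show (m : ℤ) + 3 + 1 = m + 4 by ring, show (m : ℤ) + 3 + 2 = m + 5 by ring,
      h₁, h₂, h₃, h₄, h₅]
    ring
  | odd m h₁ h₂ h₃ h₄ =>
    have := normEDS_odd (2 : ℤ) 3 2 ((m : ℤ) + 2)
    push_cast at *
    rw [this, show (m : ℤ) + 2 - 1 = m + 1 by ring, show (m : ℤ) + 2 + 1 = m + 3 by ring,
      show (m : ℤ) + 2 + 2 = m + 4 by ring, h₁, h₂, h₃, h₄]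
    ring

namespace WeierstrassCurve.Affine.Point

variable {K : Type*} [Field K] [DecidableEq K] {W : Affine K} {x y : K}

lemma divisionSeq_eq_zero_iff_of_forall_ne {r : ℕ} (h : W.Nonsingular x y)
    (hr : ∀ k, 0 < k → k < r → k • some x y h ≠ 0) (hr₁ : 1 ≤ r) :
    divisionSeq W x y r = 0 ↔ r • some x y h = 0 := by
  rw [divisionSeq_eq_xDiffSeq h hr r le_rfl, xDiffSeq_eq_zero_iff h hr hr₁]

lemma divisionSeq_mul_of_forall_ne (h : W.Nonsingular x y)
    (hne : ∀ n : ℕ, 0 < n → divisionSeq W x y n ≠ 0) (n k : ℕ) :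
    divisionSeq W x y (2 * n + k + 3 : ℕ) * divisionSeq W x y (k + 1 : ℕ) =
      divisionSeq W x y (n + k + 3 : ℕ) * divisionSeq W x y (n + k + 1 : ℕ) *
          divisionSeq W x y (n + 1 : ℕ) ^ 2 -
        divisionSeq W x y (n + 2 : ℕ) * divisionSeq W x y n *
          divisionSeq W x y (n + k + 2 : ℕ) ^ 2 := by
  have hP : ∀ m : ℕ, 0 < m → m • some x y h ≠ 0 := by
    intro m
    induction m using Nat.strong_induction_on with
    | _ m ih =>
    intro hm
    rw [Ne, ← divisionSeq_eq_zero_iff_of_forall_ne h (fun k hk hkm ↦ ih k hkm hk) hm]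
    exact hne m hm
  have hr : ∀ r : ℕ, ∀ k, 0 < k → k < r → k • some x y h ≠ 0 := fun _ k hk _ ↦ hP k hk
  have hu : ∀ m : ℕ, divisionSeq W x y m = xDiffSeq h m :=
    fun m ↦ divisionSeq_eq_xDiffSeq h (hr m) m le_rfl
  simp only [hu]
  have key : ∀ m, xDiffSeq h (m + 2) * xDiffSeq h m =
      xDiffSeq h (m + 1) ^ 2 * (x - (some x y h).xSeq (m + 1)) := by
    rintro (_ | m)
    · rw [xSeq_one]
      simp [xDiffSeq, differenceSeq]
    · exact xDiffSeq_succ_mul h (hr (m + 2)) (by omega) (by omega)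
  have h₁ := xDiffSeq_mul_eq h (hr _) (n := n + 1) (k := k + 1) (by omega) (by omega) le_rfl
  have h₂ := key n
  have h₃ := key (n + k + 1)
  rw [show 2 * (n + 1) + (k + 1) = 2 * n + k + 3 by ring,
    show n + 1 + (k + 1) = n + k + 2 by ring] at h₁
  simp only [add_assoc, Nat.reduceAdd] at *
  linear_combination h₁ + xDiffSeq h (n + (k + 2)) ^ 2 * h₂ - xDiffSeq h (n + 1) ^ 2 * h₃

end WeierstrassCurve.Affine.Point

section Ward

lemma normEDS_mul_of_forall_ne {K : Type*} [Field K] (b c d : K)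
    (hne : ∀ n : ℕ, 0 < n → normEDS b c d n ≠ 0) (n k : ℕ) :
    normEDS b c d (2 * n + k + 3 : ℕ) * normEDS b c d (k + 1 : ℕ) =
      normEDS b c d (n + k + 3 : ℕ) * normEDS b c d (n + k + 1 : ℕ) *
          normEDS b c d (n + 1 : ℕ) ^ 2 -
        normEDS b c d (n + 2 : ℕ) * normEDS b c d n * normEDS b c d (n + k + 2 : ℕ) ^ 2 := by
  classical
  have hb : b ≠ 0 := by simpa using hne 2 two_pos
  have hc : c ≠ 0 := by simpa using hne 3 three_pos
  -- The coefficients are chosen so that ψ₂, Ψ₃ and preΨ₄ take the values b, c, d at the point (0,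
  -- 0).
  let W : Affine K := ⟨(d + b ^ 4) / (b * c), c / b ^ 2, b, 0, 0⟩
  have h : W.Nonsingular 0 0 := by simp [Affine.nonsingular_zero, W, hb]
  have hs : ∀ n : ℤ, Affine.Point.divisionSeq W 0 0 n = normEDS b c d n := by
    intro n
    rw [Affine.Point.divisionSeq]
    congr 1
    · simp [W]
    · simp [W, Ψ₃, b₈]
      field_simp
    · simp [W, preΨ₄, b₈, b₄, b₆]
      field_simp
      ring
  simpa only [hs] using Affine.Point.divisionSeq_mul_of_forall_ne h
    (fun n hn ↦ by rw [hs]; exact hne n hn) n k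

/-- Ward's relation for normalised elliptic divisibility sequences. -/
theorem normEDS_mul {R : Type*} [CommRing R] (b c d : R) (n k : ℕ) :
    normEDS b c d (2 * n + k + 3 : ℕ) * normEDS b c d (k + 1 : ℕ) =
      normEDS b c d (n + k + 3 : ℕ) * normEDS b c d (n + k + 1 : ℕ) *
          normEDS b c d (n + 1 : ℕ) ^ 2 -
        normEDS b c d (n + 2 : ℕ) * normEDS b c d n * normEDS b c d (n + k + 2 : ℕ) ^ 2 := by
  -- The relation is a polynomial identity over ℤ: it is checked in the fraction field of ℤ[b, c,
  -- d], where no term of positive index vanishes, and then specialised.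
  let A := MvPolynomial (Fin 3) ℤ
  let t : Fin 3 → A := MvPolynomial.X
  have hA : ∀ n : ℕ, 0 < n → normEDS (t 0) (t 1) (t 2) n ≠ 0 := by
    intro n hn h₀
    have := congrArg (MvPolynomial.eval ![(2 : ℤ), 3, 2]) h₀
    rw [map_normEDS] at this
    simp only [t, MvPolynomial.eval_X, map_zero] at this
    simp only [Matrix.cons_val] at this
    rw [normEDS_two_three_two] at this
    omega
  have huniv : normEDS (t 0) (t 1) (t 2) (2 * n + k + 3 : ℕ) *
      normEDS (t 0) (t 1) (t 2) (k + 1 : ℕ) =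
      normEDS (t 0) (t 1) (t 2) (n + k + 3 : ℕ) * normEDS (t 0) (t 1) (t 2) (n + k + 1 : ℕ) *
          normEDS (t 0) (t 1) (t 2) (n + 1 : ℕ) ^ 2 -
        normEDS (t 0) (t 1) (t 2) (n + 2 : ℕ) * normEDS (t 0) (t 1) (t 2) n *
          normEDS (t 0) (t 1) (t 2) (n + k + 2 : ℕ) ^ 2 := by
    apply FaithfulSMul.algebraMap_injective A (FractionRing A)
    simp only [map_mul, map_sub, map_pow, map_normEDS]
    refine normEDS_mul_of_forall_ne _ _ _ (fun n hn ↦ ?_) n k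
    rw [← map_normEDS, Ne, FaithfulSMul.algebraMap_eq_zero_iff]
    exact hA n hn
  have := congrArg (MvPolynomial.eval₂Hom (Int.castRingHom R) ![b, c, d]) huniv
  simp only [map_mul, map_sub, map_pow, map_normEDS, t, MvPolynomial.coe_eval₂Hom,
    MvPolynomial.eval₂_X] at this
  exact this

variable {K : Type*} [Field K] {b c d : K} {r : ℕ}

/-- Since u(r) = 0, Ward's relation loses one of its two terms. This gives u(r+j)u(r-j) =
u(r+1)u(r-1)u(j)² for 0 < j < r and u(a+2r)u(a) = -u(r+1)u(r-1)u(a+r)², so nonvanishing spreads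
along each nonzero residue class. -/
lemma normEDS_ne_zero_of_not_dvd (hr₀ : normEDS b c d r = 0)
    (hr : ∀ j : ℕ, 0 < j → j < r → normEDS b c d j ≠ 0)
    (hr₁ : normEDS b c d (r + 1 : ℕ) ≠ 0) (hr₂ : 2 ≤ r) {m : ℕ} (hm : ¬ r ∣ m) :
    normEDS b c d m ≠ 0 := by
  obtain ⟨r, rfl⟩ := Nat.exists_eq_add_of_le' (show 1 ≤ r by omega)
  have hr' := hr r (by omega) (by omega)
  have key : ∀ j, 0 < j → j < r + 1 → ∀ k, normEDS b c d (j + k * (r + 1) : ℕ) ≠ 0 ∧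
      normEDS b c d (j + (k + 1) * (r + 1) : ℕ) ≠ 0 := by
    intro j hj hjr k
    induction k with
    | zero =>
      refine ⟨by simpa using hr j hj hjr, ?_⟩
      obtain ⟨j, rfl⟩ := Nat.exists_eq_add_of_le' hj
      obtain ⟨i, hi⟩ := Nat.exists_eq_add_of_lt hjr
      have := normEDS_mul b c d j i
      rw [show j + i + 2 = r + 1 by omega, hr₀, show j + i + 1 = r by omega,
        show j + i + 3 = r + 1 + 1 by omega, show 2 * j + i + 3 = j + 1 + (0 + 1) * (r + 1) by
          omega] at this
      refine left_ne_zero_of_mul (b := normEDS b c d (i + 1 : ℕ)) ?_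
      rw [this, zero_pow two_ne_zero, mul_zero, sub_zero]
      exact mul_ne_zero (mul_ne_zero hr₁ hr') (pow_ne_zero 2 (hr _ (by omega) hjr))
    | succ k ih =>
      refine ⟨ih.2, ?_⟩
      have := normEDS_mul b c d r (j + k * (r + 1) - 1)
      have hpos : 1 ≤ j + k * (r + 1) := by omega
      rw [hr₀, show j + k * (r + 1) - 1 + 1 = j + k * (r + 1) by omega,
        show r + (j + k * (r + 1) - 1) + 2 = j + (k + 1) * (r + 1) by
          rw [add_mul k]; omega,
        show 2 * r + (j + k * (r + 1) - 1) + 3 = j + (k + 1 + 1) * (r + 1) by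
          rw [add_mul (k + 1), add_mul k]; omega] at this
      refine left_ne_zero_of_mul (b := normEDS b c d (j + k * (r + 1) : ℕ)) ?_
      rw [this, zero_pow two_ne_zero, mul_zero, zero_sub]
      exact neg_ne_zero.mpr (mul_ne_zero (mul_ne_zero hr₁ hr') (pow_ne_zero 2 ih.2))
  have := (key (m % (r + 1)) (Nat.pos_of_ne_zero fun h ↦ hm (Nat.dvd_of_mod_eq_zero h))
    (Nat.mod_lt _ (by omega)) (m / (r + 1))).1
  rwa [mul_comm, Nat.mod_add_div] at this

end Ward

/-! ### Prime torsion as the zero locus of the division polynomial. -/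

namespace WeierstrassCurve.Affine.Point

variable {K : Type*} [Field K] {W : Affine K} {x y : K}

/-- At a zero of Ψ₃ this gives preΨ₄ = -ψ₂⁴, which settles the index after 3. -/
lemma preΨ₄_eval_add (h : W.Nonsingular x y) :
    W.preΨ₄.eval x + (2 * y + W.a₁ * x + W.a₃) ^ 4 =
      (6 * x ^ 2 + W.b₂ * x + W.b₄) * W.Ψ₃.eval x := by
  rw [show ∀ t : K, t ^ 4 = (t ^ 2) ^ 2 from fun t ↦ by ring, ψ₂_sq_eq h]
  simp [Ψ₂Sq, preΨ₄, Ψ₃, b₂, b₄, b₆, b₈]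
  ring

/-- At a 2-torsion point the y-derivative of the equation vanishes and Ψ₃ is minus the square of the
x-derivative, nonzero by nonsingularity. -/
lemma Ψ₃_eval_ne_zero (h : W.Nonsingular x y) (hy : 2 * y + W.a₁ * x + W.a₃ = 0) :
    W.Ψ₃.eval x ≠ 0 := by
  have e := (equation_iff ..).mp h.1
  have hN : 3 * x ^ 2 + 2 * W.a₂ * x + W.a₄ - W.a₁ * y ≠ 0 := by
    intro h₀
    rcases ((nonsingular_iff ..).mp h).2 with h₁ | h₁
    · exact h₁ (by linear_combination -h₀)
    · exact h₁ (by linear_combination hy)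
  have : W.Ψ₃.eval x = -(3 * x ^ 2 + 2 * W.a₂ * x + W.a₄ - W.a₁ * y) ^ 2 := by
    simp [Ψ₃, b₂, b₄, b₆, b₈]
    linear_combination ((3 * x + W.a₂) * (2 * y + W.a₁ * x + W.a₃)
      - W.a₁ * (3 * x ^ 2 + 2 * W.a₂ * x + W.a₄ - W.a₁ * y)) * hy
      - (12 * x + 4 * W.a₂ + W.a₁ ^ 2) * e
  rw [this]
  exact neg_ne_zero.mpr (pow_ne_zero 2 hN)

variable (W x y) in
lemma divisionSeq_mul (n k : ℕ) :
    divisionSeq W x y (2 * n + k + 3 : ℕ) * divisionSeq W x y (k + 1 : ℕ) =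
      divisionSeq W x y (n + k + 3 : ℕ) * divisionSeq W x y (n + k + 1 : ℕ) *
          divisionSeq W x y (n + 1 : ℕ) ^ 2 -
        divisionSeq W x y (n + 2 : ℕ) * divisionSeq W x y n *
          divisionSeq W x y (n + k + 2 : ℕ) ^ 2 :=
  normEDS_mul ..

variable [DecidableEq K]

/-- A nonsingular point is killed by a prime `n` if and only if the `n`-th division polynomial
vanishes at it. -/
theorem divisionSeq_eq_zero_iff (h : W.Nonsingular x y) {n : ℕ} (hn : n.Prime) :
    divisionSeq W x y n = 0 ↔ n • some x y h = 0 := by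
  constructor
  · intro h₀
    obtain ⟨r, hr, hrn⟩ : ∃ r, (0 < r ∧ r • some x y h = 0) ∧ ∀ k, 0 < k → k < r →
        k • some x y h ≠ 0 := by
      have hex : ∃ r, 0 < r ∧ r • some x y h = 0 := by
        by_contra! hne
        exact hne n hn.pos ((divisionSeq_eq_zero_iff_of_forall_ne h
          (fun k hk _ ↦ hne k hk) hn.pos).mp h₀)
      classical
      exact ⟨Nat.find hex, Nat.find_spec hex, fun k hk hkr h₁ ↦ Nat.find_min hex hkr ⟨hk, h₁⟩⟩
    have hr₀ := (divisionSeq_eq_zero_iff_of_forall_ne h hrn hr.1).mpr hr.2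
    have hj : ∀ j : ℕ, 0 < j → j < r → divisionSeq W x y j ≠ 0 := fun j hj hjr ↦ by
      rw [Ne, divisionSeq_eq_zero_iff_of_forall_ne h (fun k hk hkj ↦ hrn k hk (hkj.trans hjr)) hj]
      exact hrn j hj hjr
    have hr₂ : 2 ≤ r := by
      by_contra! hlt
      obtain rfl : r = 1 := by omega
      exact some_ne_zero h (by simpa using hr.2)
    have hr₁ : divisionSeq W x y (r + 1 : ℕ) ≠ 0 := by
      match r, hr₂ with
      | 2, _ =>
        have hb : 2 * y + W.a₁ * x + W.a₃ = 0 := by simpa [divisionSeq] using hr₀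
        simpa [divisionSeq] using Ψ₃_eval_ne_zero h hb
      | 3, _ =>
        have hb : 2 * y + W.a₁ * x + W.a₃ ≠ 0 := by
          simpa [divisionSeq] using hj 2 two_pos (by omega)
        have hc : W.Ψ₃.eval x = 0 := by simpa [divisionSeq] using hr₀
        have hd := preΨ₄_eval_add h
        rw [hc, mul_zero] at hd
        have : W.preΨ₄.eval x ≠ 0 := by
          rw [eq_neg_of_add_eq_zero_left hd]
          exact neg_ne_zero.mpr (pow_ne_zero 4 hb)
        simpa [divisionSeq] using ⟨this, hb⟩
      | r + 4, _ =>
        -- With the first zero at R = r + 4, this reads u(R+1)u(R-3) = -u(3)u(1)u(R-1)².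
        have := divisionSeq_mul W x y 1 r
        rw [show 1 + r + 3 = r + 4 by ring, hr₀] at this
        refine left_ne_zero_of_mul (b := divisionSeq W x y (r + 1 : ℕ)) ?_
        rw [show r + 4 + 1 = 2 * 1 + r + 3 by ring, this, zero_mul, zero_mul, zero_sub]
        refine neg_ne_zero.mpr (mul_ne_zero (mul_ne_zero ?_ ?_) (pow_ne_zero 2 ?_)) <;>
          exact hj _ (by omega) (by omega)
    have hdvd : r ∣ n := by
      by_contra hnd
      exact normEDS_ne_zero_of_not_dvd hr₀ hj hr₁ hr₂ hnd h₀
    obtain ⟨k, rfl⟩ := hdvd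
    rw [mul_comm, mul_smul, hr.2, smul_zero]
  · intro h₀
    have := Fact.mk hn
    -- Primality makes n the exact order of P, so no earlier multiple vanishes.
    have hord := addOrderOf_eq_prime h₀ (some_ne_zero h)
    refine (divisionSeq_eq_zero_iff_of_forall_ne h (fun k hk hkn hk₀ ↦ ?_) hn.pos).mpr h₀
    have := addOrderOf_dvd_of_nsmul_eq_zero hk₀
    rw [hord] at this
    exact absurd (Nat.le_of_dvd hk this) (by omega)

omit [DecidableEq K] in
lemma divisionSeq_eq_preΨ (h : W.Nonsingular x y) {n : ℕ} (hn : Odd n) :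
    divisionSeq W x y n = (W.preΨ n).eval x := by
  have hn' : ¬ Even (n : ℤ) := by
    rwa [Int.not_even_iff_odd, Int.odd_coe_nat]
  rw [divisionSeq, normEDS, if_neg hn', mul_one, preΨ, ← Polynomial.coe_evalRingHom,
    map_preNormEDS, Polynomial.coe_evalRingHom, Polynomial.eval_pow, ← ψ₂_sq_eq h, ← pow_mul]

end WeierstrassCurve.Affine.Point

/-! ### Division polynomials under a change of variables. -/

/-- The n-th division polynomial has weight n² - 1; for even n the factor ψ₂ of weight 3 is removed,
leaving n² - 4. The powers v and v⁴ on the left avoid subtraction in the exponent. -/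
lemma preNormEDS'_scale {K : Type*} [Field K] {v : K} (hv : v ≠ 0) (b c d : K) (n : ℕ) :
    v ^ (if Even n then 4 else 1) * preNormEDS' (v ^ 12 * b) (v ^ 8 * c) (v ^ 12 * d) n =
      v ^ (n ^ 2) * preNormEDS' b c d n := by
  induction n using normEDSRec with
  | zero => simp
  | one => simp
  | two => simp
  | three => simp [show ¬ Even 3 by decide]; ring
  | four => simp [show Even 4 by decide]; ring
  | even m h₁ h₂ h₃ h₄ h₅ =>
    rw [if_pos (even_two_mul _), preNormEDS'_even, preNormEDS'_even]
    generalize preNormEDS' (v ^ 12 * b) (v ^ 8 * c) (v ^ 12 * d) = f at *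
    generalize preNormEDS' b c d = g at *
    refine mul_left_cancel₀ (pow_ne_zero 6 hv) ?_
    by_cases hm : Even m
    · simp [hm, Nat.even_add, show ¬ Even 3 by decide, show Even 4 by decide,
        show ¬ Even 5 by decide] at h₁ h₂ h₃ h₄ h₅
      trans (v ^ 4 * f (m + 2)) ^ 2 * (v * f (m + 3)) * (v * f (m + 5)) -
        (v * f (m + 1)) * (v * f (m + 3)) * (v ^ 4 * f (m + 4)) ^ 2
      · ring
      · rw [h₁, h₂, h₃, h₄, h₅]
        ring
    · simp [hm, Nat.even_add, show ¬ Even 3 by decide, show Even 4 by decide,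
        show ¬ Even 5 by decide] at h₁ h₂ h₃ h₄ h₅
      trans (v * f (m + 2)) ^ 2 * (v ^ 4 * f (m + 3)) * (v ^ 4 * f (m + 5)) -
        (v ^ 4 * f (m + 1)) * (v ^ 4 * f (m + 3)) * (v * f (m + 4)) ^ 2
      · ring
      · rw [h₁, h₂, h₃, h₄, h₅]
        ring
  | odd m h₁ h₂ h₃ h₄ =>
    rw [if_neg (Nat.not_even_two_mul_add_one _), preNormEDS'_odd, preNormEDS'_odd]
    generalize preNormEDS' (v ^ 12 * b) (v ^ 8 * c) (v ^ 12 * d) = f at *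
    generalize preNormEDS' b c d = g at *
    by_cases hm : Even m
    · simp [hm, Nat.even_add, show ¬ Even 3 by decide, show Even 4 by decide] at h₁ h₂ h₃ h₄ ⊢
      refine mul_left_cancel₀ (pow_ne_zero 3 hv) ?_
      trans (v ^ 4 * f (m + 4)) * (v ^ 4 * f (m + 2)) ^ 3 * b -
        (v * f (m + 1)) * (v * f (m + 3)) ^ 3
      · ring
      · rw [h₁, h₂, h₃, h₄]
        ring
    · simp [hm, Nat.even_add, show ¬ Even 3 by decide, show Even 4 by decide] at h₁ h₂ h₃ h₄ ⊢
      refine mul_left_cancel₀ (pow_ne_zero 3 hv) ?_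
      trans (v * f (m + 4)) * (v * f (m + 2)) ^ 3 -
        (v ^ 4 * f (m + 1)) * (v ^ 4 * f (m + 3)) ^ 3 * b
      · ring
      · rw [h₁, h₂, h₃, h₄]
        ring

namespace WeierstrassCurve

variable {K : Type*} [Field K] (W : WeierstrassCurve K) (C : VariableChange K)

lemma eval_preΨ'_variableChange_eq_zero_iff (x : K) (n : ℕ) :
    ((C • W).preΨ' n).eval ((C.u⁻¹ : Kˣ) ^ 2 * (x - C.r)) = 0 ↔ (W.preΨ' n).eval x = 0 := by
  have key := preNormEDS'_scale (C.u⁻¹).ne_zero ((W.Ψ₂Sq ^ 2).eval x) (W.Ψ₃.eval x)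
    (W.preΨ₄.eval x) n
  rw [preΨ', preΨ', ← Polynomial.coe_evalRingHom, ← Polynomial.coe_evalRingHom, map_preNormEDS',
    map_preNormEDS', Polynomial.coe_evalRingHom, Polynomial.coe_evalRingHom]
  have h₂ : (((C • W).Ψ₂Sq ^ 2).eval ((C.u⁻¹ : Kˣ) ^ 2 * (x - C.r))) =
      (C.u⁻¹ : Kˣ) ^ 12 * (W.Ψ₂Sq ^ 2).eval x := by
    simp only [Ψ₂Sq, variableChange_b₂, variableChange_b₄, variableChange_b₆]
    simp
    ring
  have h₃ : ((C • W).Ψ₃.eval ((C.u⁻¹ : Kˣ) ^ 2 * (x - C.r))) =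
      (C.u⁻¹ : Kˣ) ^ 8 * W.Ψ₃.eval x := by
    simp only [Ψ₃, variableChange_b₂, variableChange_b₄, variableChange_b₆, variableChange_b₈]
    simp
    ring
  have h₄ : ((C • W).preΨ₄.eval ((C.u⁻¹ : Kˣ) ^ 2 * (x - C.r))) =
      (C.u⁻¹ : Kˣ) ^ 12 * W.preΨ₄.eval x := by
    simp only [preΨ₄, variableChange_b₂, variableChange_b₄, variableChange_b₆, variableChange_b₈]
    simp [b₂, b₄, b₆, b₈]
    ring
  rw [h₂, h₃, h₄, ← mul_eq_zero_iff_left (pow_ne_zero _ (C.u⁻¹).ne_zero), key,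
    mul_eq_zero_iff_left (pow_ne_zero _ (C.u⁻¹).ne_zero)]

variable {W} in
lemma equation_variableChange {x y : K} (h : W.toAffine.Equation x y) :
    (C • W).toAffine.Equation ((C.u⁻¹ : Kˣ) ^ 2 * (x - C.r))
      ((C.u⁻¹ : Kˣ) ^ 3 * (y - C.s * (x - C.r) - C.t)) := by
  rw [Affine.equation_iff] at h ⊢
  simp only [variableChange_a₁, variableChange_a₂, variableChange_a₃, variableChange_a₄,
    variableChange_a₆]
  linear_combination ((C.u⁻¹ : Kˣ) : K) ^ 6 * h

lemma exists_equation [IsAlgClosed K] (x : K) : ∃ y, W.toAffine.Equation x y := by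
  obtain ⟨y, hy⟩ := IsAlgClosed.exists_root
    (W.toAffine.polynomial.map (Polynomial.evalRingHom x)) (by
      rw [(W.toAffine.monic_polynomial).degree_map, W.toAffine.degree_polynomial]
      decide)
  exact ⟨y, by simpa [Affine.Equation, Polynomial.evalEval, Polynomial.IsRoot,
    Polynomial.map_evalRingHom_eval] using hy⟩

end WeierstrassCurve

/-! ### The division polynomial of a supersingular curve. -/

section Supersingular

open Polynomial

variable {p : ℕ} [Fact p.Prime] {k : Type*} [Field k] [CharP k p] {V : WeierstrassCurve k}
  [V.IsElliptic]

lemma IsSupersingularCurve.eval_preΨ_ne_zero (hV : IsSupersingularCurve p V) (hp : Odd p)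
    (x : AlgebraicClosure k) : ((V.baseChange (AlgebraicClosure k)).preΨ p).eval x ≠ 0 := by
  classical
  intro hx
  obtain ⟨y, hy⟩ := (V.baseChange (AlgebraicClosure k)).exists_equation x
  have : WeierstrassCurve.IsElliptic (V.baseChange (AlgebraicClosure k)).toAffine :=
    inferInstanceAs (V.map (algebraMap k (AlgebraicClosure k))).IsElliptic
  have hns := Affine.equation_iff_nonsingular.mp hy
  rw [← Affine.Point.divisionSeq_eq_preΨ hns hp,
    Affine.Point.divisionSeq_eq_zero_iff hns Fact.out] at hx
  refine Affine.Point.some_ne_zero hns (hV _ ?_)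
  convert hx

lemma IsSupersingularCurve.coeff_preΨ (hV : IsSupersingularCurve p V) (hp : Odd p) :
    (V.preΨ p).coeff 0 ≠ 0 ∧ ∀ i, i ≠ 0 → (V.preΨ p).coeff i = 0 := by
  have hdeg : (V.preΨ p).degree = 0 := by
    by_contra hne
    -- The zero polynomial also has a root, so this excludes it together with positive degree.
    obtain ⟨x, hx⟩ := IsAlgClosed.exists_root
      ((V.preΨ p).map (algebraMap k (AlgebraicClosure k))) (by rwa [degree_map])
    refine hV.eval_preΨ_ne_zero hp x ?_
    rwa [WeierstrassCurve.baseChange, map_preΨ]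
  refine ⟨?_, fun i hi ↦ coeff_eq_zero_of_natDegree_lt ?_⟩
  · intro h
    rw [eq_C_of_degree_eq_zero hdeg, h, C_0, degree_zero] at hdeg
    simp at hdeg
  · rw [natDegree_eq_of_degree_eq_some hdeg]
    exact Nat.pos_of_ne_zero hi

end Supersingular

/-! ### Absolute values of p-torsion coordinates and ramification. -/

section

open Polynomial

namespace PadicAlgCl

variable {p : ℕ} [Fact p.Prime]

lemma norm_algebraMap_padicInt (c : ℤ_[p]) : ‖algebraMap ℤ_[p] (PadicAlgCl p) c‖ = ‖c‖ := by
  rw [IsScalarTower.algebraMap_apply ℤ_[p] ℚ_[p] (PadicAlgCl p)]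
  exact norm_extends p c

lemma norm_add_eq_left {s t : PadicAlgCl p} (h : ‖t‖ < ‖s‖) : ‖s + t‖ = ‖s‖ := by
  rw [IsUltrametricDist.norm_add_eq_max_of_norm_ne_norm h.ne', max_eq_left h.le]

lemma norm_aeval_le_one (f : ℤ_[p][X]) {t : PadicAlgCl p} (ht : ‖t‖ ≤ 1) : ‖aeval t f‖ ≤ 1 := by
  rw [aeval_eq_sum_range]
  refine IsUltrametricDist.norm_sum_le_of_forall_le_of_nonneg zero_le_one fun i _ ↦ ?_
  rw [Algebra.smul_def, norm_mul, norm_algebraMap_padicInt, norm_pow]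
  exact mul_le_one₀ (PadicInt.norm_le_one _) (by positivity) (pow_le_one₀ (norm_nonneg _) ht)

lemma norm_aeval_of_monic {f : ℤ_[p][X]} (hf : f.Monic) {t : PadicAlgCl p} (ht : 1 < ‖t‖) :
    ‖aeval t f‖ = ‖t‖ ^ f.natDegree := by
  conv_lhs => rw [hf.as_sum]
  rw [map_add, map_pow, aeval_X, ← norm_pow]
  refine norm_add_eq_left ?_
  rw [map_sum, norm_pow]
  rcases Nat.eq_zero_or_pos f.natDegree with h | h
  · simp [h]
  refine lt_of_le_of_lt (IsUltrametricDist.norm_sum_le_of_forall_le_of_nonneg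
    (C := ‖t‖ ^ (f.natDegree - 1)) (by positivity) fun i hi ↦ ?_)
    (pow_lt_pow_right₀ ht (by omega))
  rw [map_mul, aeval_C, map_pow, aeval_X, norm_mul, norm_algebraMap_padicInt, norm_pow]
  rw [Finset.mem_range] at hi
  calc _ ≤ 1 * ‖t‖ ^ (f.natDegree - 1) := by
        gcongr
        · exact PadicInt.norm_le_one _
        · exact ht.le
        · omega
    _ = _ := one_mul _

/-- The absolute value of a root of an integral polynomial with leading coefficient `p`, unit
constant term, and all other coefficients divisible by `p`. -/
lemma norm_pow_eq_of_root {f : ℤ_[p][X]} {n : ℕ} (hn : n ≠ 0) (hfn : f.natDegree = n)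
    (hlead : f.coeff n = p) (h₀ : ‖f.coeff 0‖ = 1) (hf : ∀ i, i ≠ 0 → (p : ℤ_[p]) ∣ f.coeff i)
    {t : PadicAlgCl p} (ht : aeval t f = 0) : 1 < ‖t‖ ∧ ‖t‖ ^ n = p := by
  have hp : (p : ℤ_[p]) ≠ 0 := by simpa using (Fact.out : p.Prime).ne_zero
  -- Writing f = f(0) + p·g with g monic gives |g(t)| = p > 1 at a root t; integrality of g forces
  -- |t| > 1, and then the leading term of g dominates.
  obtain ⟨g, hg⟩ : C (p : ℤ_[p]) ∣ f - C (f.coeff 0) := by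
    rw [C_dvd_iff_dvd_coeff]
    intro i
    rcases eq_or_ne i 0 with rfl | hi
    · simp
    · simpa [coeff_C_of_ne_zero hi] using hf i hi
  have hgn : g.natDegree = n := by
    rw [← hfn, ← natDegree_C_mul hp, ← hg, natDegree_sub_C]
  have hmonic : g.Monic := by
    have := congrArg (fun q ↦ q.coeff n) hg
    simp only [coeff_sub, coeff_C_of_ne_zero hn, sub_zero, coeff_C_mul, hlead] at this
    rw [Monic, leadingCoeff, hgn]
    exact (mul_right_eq_self₀.mp this.symm).resolve_right hp
  have hnorm : ‖aeval t g‖ = p := by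
    have := congrArg (fun q ↦ ‖aeval t q‖) hg
    simp only [map_sub, ht, zero_sub, norm_neg, aeval_C, map_mul, norm_mul,
      norm_algebraMap_padicInt, h₀, PadicInt.norm_p] at this
    have hp' : (p : ℝ) ≠ 0 := by simpa using (Fact.out : p.Prime).ne_zero
    field_simp at this
    exact this.symm
  have hp₁ : (1 : ℝ) < p := by exact_mod_cast (Fact.out : p.Prime).one_lt
  have ht₁ : 1 < ‖t‖ := by
    by_contra! hle
    linarith [norm_aeval_le_one g hle]
  exact ⟨ht₁, by rw [← hgn, ← norm_aeval_of_monic hmonic ht₁, hnorm]⟩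

/-- On an integral Weierstrass equation, points with `|x| > 1` satisfy `|y|² = |x|³`. -/
lemma norm_sq_eq_of_equation {W : WeierstrassCurve ℤ_[p]} {x y : PadicAlgCl p}
    (h : (W.baseChange (PadicAlgCl p)).toAffine.Equation x y) (hx : 1 < ‖x‖) :
    ‖y‖ ^ 2 = ‖x‖ ^ 3 := by
  have hcubic : ‖aeval x (X ^ 3 + C W.a₂ * X ^ 2 + C W.a₄ * X + C W.a₆)‖ = ‖x‖ ^ 3 := by
    have hdeg : (X ^ 3 + C W.a₂ * X ^ 2 + C W.a₄ * X + C W.a₆).natDegree = 3 := by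
      compute_degree!
    have hmon : (X ^ 3 + C W.a₂ * X ^ 2 + C W.a₄ * X + C W.a₆).Monic := by
      monicity!
    rw [norm_aeval_of_monic hmon hx, hdeg]
  have e := (Affine.equation_iff ..).mp h
  have hle : ∀ c : ℤ_[p], ‖algebraMap ℤ_[p] (PadicAlgCl p) c‖ ≤ 1 := fun c ↦ by
    rw [norm_algebraMap_padicInt]; exact PadicInt.norm_le_one c
  have hlin : ‖algebraMap ℤ_[p] (PadicAlgCl p) W.a₁ * x +
      algebraMap ℤ_[p] (PadicAlgCl p) W.a₃‖ ≤ ‖x‖ := by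
    refine (IsUltrametricDist.norm_add_le_max _ _).trans (max_le ?_ ((hle _).trans hx.le))
    rw [norm_mul]
    exact mul_le_of_le_one_left (norm_nonneg _) (hle _)
  have e' : ‖y ^ 2 + (algebraMap ℤ_[p] (PadicAlgCl p) W.a₁ * x +
      algebraMap ℤ_[p] (PadicAlgCl p) W.a₃) * y‖ = ‖x‖ ^ 3 := by
    rw [← hcubic]
    congr 1
    simp [WeierstrassCurve.baseChange] at e ⊢
    linear_combination e
  -- Otherwise the left side of the equation would have norm at most |x|², not |x|³. Once |y| > |x|,
  -- the term y² dominates.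
  have hxy : ‖x‖ < ‖y‖ := by
    by_contra! hyx
    have h₁ : ‖y ^ 2 + (algebraMap ℤ_[p] (PadicAlgCl p) W.a₁ * x +
        algebraMap ℤ_[p] (PadicAlgCl p) W.a₃) * y‖ ≤ ‖x‖ ^ 2 := by
      refine (IsUltrametricDist.norm_add_le_max _ _).trans (max_le ?_ ?_)
      · rw [norm_pow]; gcongr
      · rw [norm_mul, sq]; gcongr
    rw [e'] at h₁
    exact absurd (pow_lt_pow_right₀ hx (show 2 < 3 by norm_num)) (not_lt.mpr h₁)
  rw [← e', ← norm_pow]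
  symm
  refine norm_add_eq_left ?_
  rw [norm_mul, norm_pow, sq]
  have : 0 < ‖y‖ := (norm_nonneg _).trans_lt hxy
  gcongr
  exact hlin.trans_lt hxy

/-- If `|z|ⁿ = p⁻¹`, then `n` divides the degree of any finite extension of `ℚ_p` containing
`z`. -/
lemma dvd_finrank_of_norm_pow {M : IntermediateField ℚ_[p] (PadicAlgCl p)}
    {z : PadicAlgCl p} (hz : z ∈ M) {n : ℕ} (hn : ‖z‖ ^ n = (p : ℝ)⁻¹) :
    n ∣ Module.finrank ℚ_[p] M := by
  have hint : IsIntegral ℚ_[p] z := Algebra.IsIntegral.isIntegral z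
  have hp₁ : (1 : ℝ) < p := by exact_mod_cast (Fact.out : p.Prime).one_lt
  have hz₀ : z ≠ 0 := by
    rintro rfl
    have hpos : (0 : ℝ) < (p : ℝ)⁻¹ := by positivity
    have hlt : (p : ℝ)⁻¹ < 1 := inv_lt_one_of_one_lt₀ hp₁
    rcases Nat.eq_zero_or_pos n with rfl | h
    · exact (Fact.out : p.Prime).one_lt.ne' (by simpa using hn)
    · rw [norm_zero, zero_pow h.ne'] at hn; linarith
  have hdeg : (minpoly ℚ_[p] z).natDegree ∣ Module.finrank ℚ_[p] M := by
    have : minpoly ℚ_[p] z = minpoly ℚ_[p] (⟨z, hz⟩ : M) :=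
      (minpoly.algebraMap_eq (algebraMap M (PadicAlgCl p)).injective (⟨z, hz⟩ : M))
    rw [this]
    exact minpoly.degree_dvd (Algebra.IsIntegral.isIntegral _)
  refine dvd_trans ?_ hdeg
  have hpos := minpoly.natDegree_pos hint
  have hc : (minpoly ℚ_[p] z).coeff 0 ≠ 0 := minpoly.coeff_zero_ne_zero hint hz₀
  -- The right side is an integral power p^(-k). Raising to the n-th power gives deg z = k·n.
  have hnorm : ‖z‖ ^ (minpoly ℚ_[p] z).natDegree = ‖(minpoly ℚ_[p] z).coeff 0‖ := by
    rw [← spectralNorm_eq, spectralNorm.spectralNorm_eq_norm_coeff_zero_rpow, ← Real.rpow_natCast,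
      ← Real.rpow_mul (norm_nonneg _), one_div_mul_cancel (by positivity), Real.rpow_one]
  rw [Padic.norm_eq_zpow_neg_valuation hc] at hnorm
  generalize ((minpoly ℚ_[p] z).coeff 0).valuation = k at hnorm
  have key : (p : ℝ) ^ (-((minpoly ℚ_[p] z).natDegree : ℤ)) = (p : ℝ) ^ (-k * n) := by
    rw [zpow_mul, zpow_natCast, ← hnorm, ← pow_mul, mul_comm, pow_mul, hn, zpow_neg, zpow_natCast,
      inv_pow]
  have := zpow_right_injective₀ (by positivity) hp₁.ne' key
  rw [← Int.natCast_dvd_natCast]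
  exact ⟨k, by linarith⟩

end PadicAlgCl

end

/-! ### Degree of the field of definition. -/

section

open Polynomial IntermediateField

lemma IntermediateField.finrank_adjoin_pair_le {F E : Type*} [Field F] [Field E] [Algebra F E]
    [Algebra.IsAlgebraic F E] {x y : E} {f : F[X]} (hf : f ≠ 0) (hx : aeval x f = 0)
    {g : F⟮x⟯[X]} (hg : g ≠ 0) (hy : aeval y g = 0) :
    Module.finrank F F⟮x, y⟯ ≤ f.natDegree * g.natDegree := by
  have hxi : IsIntegral F x := Algebra.IsIntegral.isIntegral x
  have hyi : IsIntegral F⟮x⟯ y := (Algebra.IsIntegral.isIntegral (R := F) y).tower_top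
  rw [← adjoin_simple_adjoin_simple]
  change Module.finrank F F⟮x⟯⟮y⟯ ≤ _
  rw [← Module.finrank_mul_finrank F F⟮x⟯ F⟮x⟯⟮y⟯, adjoin.finrank hxi, adjoin.finrank hyi]
  exact Nat.mul_le_mul (natDegree_le_of_dvd (minpoly.dvd _ _ hx) hf)
    (natDegree_le_of_dvd (minpoly.dvd _ _ hy) hg)

lemma WeierstrassCurve.finrank_adjoin_le {F E : Type*} [Field F] [Field E] [Algebra F E]
    [Algebra.IsAlgebraic F E] {W : WeierstrassCurve F} {x y : E}
    (h : (W.baseChange E).toAffine.Equation x y) {f : F[X]} (hf : f ≠ 0) (hx : aeval x f = 0) :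
    Module.finrank F F⟮x, y⟯ ≤ f.natDegree * 2 := by
  let x₀ : F⟮x⟯ := AdjoinSimple.gen F x
  let V : Affine F⟮x⟯ := (W.baseChange F⟮x⟯).toAffine
  have hmonic : (V.polynomial.map (evalRingHom x₀)).Monic := V.monic_polynomial.map _
  have hdeg : (V.polynomial.map (evalRingHom x₀)).natDegree = 2 := by
    rw [V.monic_polynomial.natDegree_map, V.natDegree_polynomial]
  rw [← hdeg]
  refine finrank_adjoin_pair_le hf hx hmonic.ne_zero ?_
  have e := (Affine.equation_iff' ..).mp h
  simp [WeierstrassCurve.baseChange] at e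
  simp [V, Affine.polynomial, WeierstrassCurve.baseChange, x₀]
  linear_combination e

section

variable {p : ℕ} [Fact p.Prime] {W : WeierstrassCurve ℤ_[p]}

lemma natDegree_preΨ_padicInt (hp : Odd p) : (W.preΨ p).natDegree = (p ^ 2 - 1) / 2 := by
  have hp₀ : ((p : ℤ) : ℤ_[p]) ≠ 0 := by simpa using (Fact.out : p.Prime).ne_zero
  rw [W.natDegree_preΨ hp₀, if_neg (by rwa [Int.not_even_iff_odd, Int.odd_coe_nat]),
    Int.natAbs_natCast]

lemma norm_coeff_zero_preΨ
    (h : ((W.map (IsLocalRing.residue ℤ_[p])).preΨ p).coeff 0 ≠ 0) : ‖(W.preΨ p).coeff 0‖ = 1 := by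
  rwa [map_preΨ, coeff_map, Ne, IsLocalRing.residue_eq_zero_iff, IsLocalRing.mem_maximalIdeal,
    mem_nonunits_iff, not_not, PadicInt.isUnit_iff] at h

lemma dvd_coeff_preΨ {i : ℕ}
    (h : ((W.map (IsLocalRing.residue ℤ_[p])).preΨ p).coeff i = 0) :
    (p : ℤ_[p]) ∣ (W.preΨ p).coeff i := by
  rwa [map_preΨ, coeff_map, IsLocalRing.residue_eq_zero_iff, IsLocalRing.mem_maximalIdeal,
    PadicInt.mem_nonunits, PadicInt.norm_lt_one_iff_dvd] at h

end

section Main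

variable {p : ℕ} [Fact p.Prime]

lemma sq_sub_one_div_two_mul (hp : Odd p) : (p ^ 2 - 1) / 2 * 2 = p ^ 2 - 1 := by
  refine Nat.div_mul_cancel ?_
  obtain ⟨k, rfl⟩ := hp
  exact ⟨2 * k ^ 2 + 2 * k, by rw [Nat.sub_eq_iff_eq_add (Nat.one_le_pow _ _ (by omega))]; ring⟩

lemma sq_sub_one_div_two_pos (hp : Odd p) : 0 < (p ^ 2 - 1) / 2 := by
  have := sq_sub_one_div_two_mul hp
  have : 1 < p ^ 2 := Nat.one_lt_pow two_ne_zero (Fact.out : p.Prime).one_lt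
  omega

/-- The field of definition of a point whose `x`-coordinate is a root of the `p`-th division
polynomial has degree `p² - 1`. -/
lemma finrank_adjoin_of_root (hp : Odd p) {E : WeierstrassCurve ℚ_[p]}
    (hE : HasGoodSupersingularReduction p E) {x y : PadicAlgCl p}
    (h : (E.baseChange (PadicAlgCl p)).toAffine.Equation x y)
    (hx : ((E.baseChange (PadicAlgCl p)).preΨ p).eval x = 0) :
    Module.finrank ℚ_[p] ℚ_[p]⟮x, y⟯ = p ^ 2 - 1 := by
  have hp₀ : ((p : ℤ) : ℚ_[p]) ≠ 0 := by simpa using (Fact.out : p.Prime).ne_zero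
  have hodd : ¬ Even (p : ℤ) := by rwa [Int.not_even_iff_odd, Int.odd_coe_nat]
  have hpos := sq_sub_one_div_two_pos hp
  have hmul := sq_sub_one_div_two_mul hp
  have hdegE : (E.preΨ p).natDegree = (p ^ 2 - 1) / 2 := by
    rw [E.natDegree_preΨ hp₀, if_neg hodd, Int.natAbs_natCast]
  have hle : Module.finrank ℚ_[p] ℚ_[p]⟮x, y⟯ ≤ p ^ 2 - 1 := by
    rw [← hmul, ← hdegE]
    refine finrank_adjoin_le h (E.preΨ_ne_zero hp₀) ?_
    rwa [WeierstrassCurve.baseChange, map_preΨ, eval_map_algebraMap] at hx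
  have : FiniteDimensional ℚ_[p] ℚ_[p]⟮x, y⟯ :=
    finiteDimensional_adjoin fun _ _ ↦ Algebra.IsIntegral.isIntegral _
  refine le_antisymm hle (Nat.le_of_dvd Module.finrank_pos ?_)
  obtain ⟨hgood, hss⟩ := hE
  set W := (E.minimal ℤ_[p]).integralModel ℤ_[p] with hW
  have : ((E.minimal ℤ_[p]).reduction ℤ_[p]).IsElliptic :=
    (hasGoodReduction_iff_isElliptic_reduction ℤ_[p]).mp hgood
  have hcoeff := hss.coeff_preΨ hp
  rw [reduction, ← hW] at hcoeff
  -- The change of variables that defines the minimal model has coefficients in ℚ_p, so the new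
  -- coordinates x', y' stay in ℚ_p(x, y).
  let C := (E.exists_isMinimal ℤ_[p]).choose
  let CL := C.map (algebraMap ℚ_[p] (PadicAlgCl p))
  have hWL : W.baseChange (PadicAlgCl p) = CL • E.baseChange (PadicAlgCl p) := by
    rw [WeierstrassCurve.baseChange, WeierstrassCurve.baseChange, map_variableChange]
    rw [show C • E = E.minimal ℤ_[p] from rfl,
      ← baseChange_integralModel_eq ℤ_[p] (E.minimal ℤ_[p]), ← hW, WeierstrassCurve.baseChange,
      WeierstrassCurve.map_map, ← IsScalarTower.algebraMap_eq]
  set x' : PadicAlgCl p := (CL.u⁻¹ : (PadicAlgCl p)ˣ) ^ 2 * (x - CL.r) with hx'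
  set y' : PadicAlgCl p := (CL.u⁻¹ : (PadicAlgCl p)ˣ) ^ 3 * (y - CL.s * (x - CL.r) - CL.t) with hy'
  have heq : (W.baseChange (PadicAlgCl p)).toAffine.Equation x' y' := by
    rw [hWL]
    exact equation_variableChange CL h
  have hroot : aeval x' (W.preΨ p) = 0 := by
    rw [← eval_map_algebraMap, ← map_preΨ, ← WeierstrassCurve.baseChange, hWL, preΨ_ofNat,
      eval_preΨ'_variableChange_eq_zero_iff, ← preΨ_ofNat]
    exact hx
  obtain ⟨hx₁, hxn⟩ := PadicAlgCl.norm_pow_eq_of_root hpos.ne' (natDegree_preΨ_padicInt hp)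
    (by
      have := W.coeff_preΨ p
      rw [if_neg hodd, if_neg hodd, Int.natAbs_natCast] at this
      simpa using this)
    (norm_coeff_zero_preΨ hcoeff.1) (fun i hi ↦ dvd_coeff_preΨ (hcoeff.2 i hi)) hroot
  have hy₁ := PadicAlgCl.norm_sq_eq_of_equation heq hx₁
  have hxM : x ∈ ℚ_[p]⟮x, y⟯ := subset_adjoin _ _ (by simp)
  have hyM : y ∈ ℚ_[p]⟮x, y⟯ := subset_adjoin _ _ (by simp)
  have hmem : ∀ a : ℚ_[p], algebraMap ℚ_[p] (PadicAlgCl p) a ∈ ℚ_[p]⟮x, y⟯ :=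
    fun a ↦ IntermediateField.algebraMap_mem _ a
  have hu : ((CL.u⁻¹ : (PadicAlgCl p)ˣ) : PadicAlgCl p) ∈ ℚ_[p]⟮x, y⟯ := hmem (C.u⁻¹ : ℚ_[p]ˣ)
  have hx'M : x' ∈ ℚ_[p]⟮x, y⟯ := mul_mem (pow_mem hu 2) (sub_mem hxM (hmem C.r))
  have hy'M : y' ∈ ℚ_[p]⟮x, y⟯ := mul_mem (pow_mem hu 3)
    (sub_mem (sub_mem hyM (mul_mem (hmem C.s) (sub_mem hxM (hmem C.r)))) (hmem C.t))
  refine PadicAlgCl.dvd_finrank_of_norm_pow (div_mem hx'M hy'M) ?_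
  have hx₀ : ‖x'‖ ≠ 0 := by positivity
  -- Here |x'/y'|² = |x'|²/|x'|³ = 1/|x'|, and its power (p² - 1)/2 is 1/p.
  rw [← hmul, norm_div, mul_comm, pow_mul, div_pow, hy₁, ← hxn]
  have : ‖x'‖ ^ 2 / ‖x'‖ ^ 3 = ‖x'‖⁻¹ := by field_simp
  rw [this, inv_pow]

end Main

end

/-! ### The theorem. -/

theorem theorem3 (p : ℕ) [Fact p.Prime] (hp2 : p ≠ 2) (hp3 : p ≠ 3)
    (E : WeierstrassCurve ℚ_[p]) [E.IsElliptic] (hE : HasGoodSupersingularReduction p E) :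
    pDegree p E = p ^ 2 - 1 ∧
      ∀ P ∈ nonzeroTorsion p E,
        Module.finrank ℚ_[p] (fieldOfPoint (F := ℚ_[p]) P) = p ^ 2 - 1 := by
  classical
  have hp : Odd p := (Fact.out : p.Prime).odd_of_ne_two hp2
  have : WeierstrassCurve.IsElliptic (E.baseChange (AlgebraicClosure ℚ_[p])).toAffine :=
    inferInstanceAs (E.map (algebraMap ℚ_[p] (AlgebraicClosure ℚ_[p]))).IsElliptic
  have hall : ∀ P ∈ nonzeroTorsion p E,
      Module.finrank ℚ_[p] (fieldOfPoint (F := ℚ_[p]) P) = p ^ 2 - 1 := by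
    rintro (_ | ⟨x, y, h⟩) ⟨hP, hP₀⟩
    · exact absurd rfl hP₀
    · refine finrank_adjoin_of_root hp hE h.1 ?_
      refine (Affine.Point.divisionSeq_eq_preΨ h hp).symm.trans
        ((Affine.Point.divisionSeq_eq_zero_iff h Fact.out).mpr ?_)
      convert hP
  -- Nonzero torsion must be exhibited, since the infimum of the empty set in ℕ is 0; a root of the
  -- division polynomial supplies it.
  obtain ⟨P, hP⟩ : ∃ P, P ∈ nonzeroTorsion p E := by
    obtain ⟨x, hx⟩ := IsAlgClosed.exists_root
      ((E.baseChange (AlgebraicClosure ℚ_[p])).preΨ p) (by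
        have hp₀ : ((p : ℤ) : AlgebraicClosure ℚ_[p]) ≠ 0 := by
          simpa using (Fact.out : p.Prime).ne_zero
        have hpos := natDegree_preΨ_pos (E.baseChange (AlgebraicClosure ℚ_[p])) (n := p) (by
          have := (Fact.out : p.Prime).two_le
          rw [Int.natAbs_natCast]
          omega) hp₀
        exact (Polynomial.natDegree_pos_iff_degree_pos.mp hpos).ne')
    obtain ⟨y, hy⟩ := (E.baseChange (AlgebraicClosure ℚ_[p])).exists_equation x
    have hns := Affine.equation_iff_nonsingular.mp hy
    refine ⟨.some x y hns, ?_, Affine.Point.some_ne_zero hns⟩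
    have := (Affine.Point.divisionSeq_eq_zero_iff hns (Fact.out : p.Prime)).mp
      ((Affine.Point.divisionSeq_eq_preΨ hns hp).trans hx)
    convert this
  refine ⟨?_, hall⟩
  have hset : {d | ∃ P ∈ nonzeroTorsion p E,
      Module.finrank ℚ_[p] (fieldOfPoint (F := ℚ_[p]) P) = d} = {p ^ 2 - 1} := by
    ext d
    constructor
    · rintro ⟨Q, hQ, rfl⟩
      exact hall Q hQ
    · rintro rfl
      exact ⟨P, hP, hall P hP⟩
  rw [pDegree, hset, csInf_singleton]
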